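/- For a finite group $H$ let $d(H)$ be the minimal number of generators of $H$, and let $r(H)=\max\{d(K) : K\le H\}$ be its rank. Let $G$ be a finite group which is purely non-abelian, i.e. has no non-trivial abelian direct factor. Let $\mathrm{Aut}_c(G)$ be the group of central automorphisms of $G$, i.e. the automorphisms of $G$ that commute with every inner automorphism. Let $R=\mathrm{Hom}(G,Z(G))$ be the ring of homomorphisms from $G$ to its center, with pointwise addition (that is, $(f+g)(x)=f(x)g(x)$) and composition of maps as multiplication, and let $R^+$ be its additive group. Then $$r(\mathrm{Aut}_c(G))\le 3\,r(R^+),$$ and if $|Z(G)|$ is odd, then $$r(\mathrm{Aut}_c(G))\le 2\,r(R^+).$$ Moreover, if $G$ is a $p$-group for a prime $p$, then $r(\mathrm{Aut}_c(G))\le 2\,d(G)\,d(Z(G))$ if $p>2$, and $r(\mathrm{Aut}_c(G))\le 3\,d(G)\,d(Z(G))$ if $p=2$. -/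

import Mathlib

/-- The rank `r(G)` of a finite group: the supremum of `d(H)` over all subgroups `H` of `G`, where
`d = Group.rank` is the minimal number of generators. (A finite group has finitely many subgroups,
so this is a supremum of a finite set of natural numbers.) -/
noncomputable def subgroupRank (G : Type*) [Group G] [Finite G] : ℕ :=
  ⨆ H : Subgroup G, Group.rank H

/-- The rank of a finite additive group, `subgroupRank` in additive notation. -/
noncomputable def addSubgroupRank (A : Type*) [AddGroup A] [Finite A] : ℕ :=
  ⨆ H : AddSubgroup A, AddGroup.rank H

/-- `G` is purely non-abelian: it has no non-trivial abelian direct factor. That is, whenever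
`G` is the internal direct product of subgroups `A` and `B` with `A` abelian, `A` is trivial. -/
def IsPurelyNonabelian (G : Type*) [Group G] : Prop :=
  ∀ A B : Subgroup G, A.Normal → B.Normal → IsCompl A B → IsMulCommutative A → A = ⊥

/-- The central automorphism group `Aut_c(G)`: the automorphisms of `G` which commute with every
inner automorphism. -/
def centralAut (G : Type*) [Group G] : Subgroup (MulAut G) :=
  Subgroup.centralizer (Set.range (MulAut.conj : G → MulAut G))

instance finite_centralAut (G : Type*) [Group G] [Finite G] : Finite (centralAut G) :=
  Finite.of_injective (fun (σ : centralAut G) (x : G) => (σ : MulAut G) x)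
    fun _ _ h => Subtype.ext (MulEquiv.ext (congrFun h))

/-- The carrier of the ring `Hom(G, Z(G))`. -/
def HomCenter (G : Type*) [Group G] : Type _ := Additive (G →* Subgroup.center G)

namespace HomCenter

open scoped IsMulCommutative

variable {G : Type*} [Group G]

/-- A homomorphism `G → Z(G)` as an element of the ring. -/
def of (f : G →* Subgroup.center G) : HomCenter G := Additive.ofMul f

/-- An element of the ring as a homomorphism `G → Z(G)`. -/
def hom (f : HomCenter G) : G →* Subgroup.center G := Additive.toMul f

theorem hom_injective : Function.Injective (hom : HomCenter G → (G →* Subgroup.center G)) :=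
  fun _ _ h => h

/-- Addition is the pointwise product of homomorphisms. -/
instance : AddCommGroup (HomCenter G) :=
  inferInstanceAs (AddCommGroup (Additive (G →* Subgroup.center G)))

/-- Multiplication is the composition of maps, `Z(G)` being included in `G`. -/
instance : Mul (HomCenter G) :=
  ⟨fun f g => of (f.hom.comp ((Subgroup.center G).subtype.comp g.hom))⟩

theorem hom_zero_apply (x : G) : (0 : HomCenter G).hom x = 1 := rfl

theorem hom_add_apply (f g : HomCenter G) (x : G) : (f + g).hom x = f.hom x * g.hom x := rfl

theorem hom_mul_apply (f g : HomCenter G) (x : G) : (f * g).hom x = f.hom (g.hom x : G) := rfl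

@[ext] theorem ext {f g : HomCenter G} (h : ∀ x, f.hom x = g.hom x) : f = g :=
  hom_injective (MonoidHom.ext h)

/-- The associative ring (without identity in general) `R = Hom(G, Z(G))`. -/
instance : NonUnitalRing (HomCenter G) :=
  { (inferInstance : AddCommGroup (HomCenter G)), (inferInstance : Mul (HomCenter G)) with
    left_distrib := fun f g h => by
      ext x
      simp [hom_mul_apply, hom_add_apply]
    right_distrib := fun f g h => by
      ext x
      simp [hom_mul_apply, hom_add_apply]
    zero_mul := fun f => by
      ext x
      simp [hom_mul_apply, hom_zero_apply]
    mul_zero := fun f => by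
      ext x
      simp [hom_mul_apply, hom_zero_apply]
    mul_assoc := fun f g h => by
      ext x
      simp [hom_mul_apply] }

instance [Finite G] : Finite (HomCenter G) :=
  Finite.of_injective (fun (f : HomCenter G) (x : G) => f.hom x) fun _ _ h => ext (congrFun h)

end HomCenter

/-! Write a central automorphism as `1 + f` with `f ∈ R = Hom(G, Z(G))`; this embeds `Aut_c(G)` in
the adjoint monoid of `R`, with operation `x + y + xy`. Some positive power of each `f` is
idempotent, and an idempotent splits off its central image as an abelian direct factor of `G`. Hence
every `f` is nilpotent. It follows that Sylow subgroups of any `H ≤ Aut_c(G)` are normal, and `d(H)`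
is bounded by the largest `d(P)` over its Sylow subgroups `P`.

For a `p`-group `P` the bound comes from `p ^ d(P) ≤ |Hom(P, 𝔽_p)|`. Let `P_i` consist of the
elements whose `f` lies in `pⁱR`. Then `|P : P_i| ≤ |R : pR|ⁱ`. For `i ≥ 1` (`i ≥ 2` if `p = 2`),
raising to the power `p` acts on the layers of `P_i` like multiplication by `p` on those of `pⁱR`,
and `AdjointHom.card_hom_le_card_layer` gives `|Hom(P_i, 𝔽_p)| ≤ |pⁱR / pⁱ⁺¹R| ≤ |R : pR|`. So `p ^
d(P) ≤ |R : pR| ^ (i + 1)`: the factor 2 is `i = 1`, the factor 3 is `i = 2`.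

Finally `|R : pR|` is at most `p ^ r(R⁺)`, and also at most `p ^ (d(G) d(Z(G)))`. -/

/-! ### Generators of `p`-groups and homomorphisms to `ZMod p`. -/

/-- A proper subgroup of a finite `p`-group is killed by a nonzero homomorphism to `ZMod p`. -/
theorem IsPGroup.exists_hom_zmod_ne_zero {p : ℕ} [Fact p.Prime] {H : Type*} [Group H] [Finite H]
    (hH : IsPGroup p H) {L : Subgroup H} (hL : L ≠ ⊤) :
    ∃ χ : Additive H →+ ZMod p, χ ≠ 0 ∧ ∀ h ∈ L, χ (Additive.ofMul h) = 0 := by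
  have hp : p.Prime := Fact.out
  obtain ⟨n, hn⟩ := IsPGroup.iff_card.mp hH
  obtain ⟨l, hl⟩ := IsPGroup.iff_card.mp (hH.to_subgroup L)
  have hlt : l < n := by
    have h1 : Nat.card L ≠ Nat.card H := fun h => hL (Subgroup.eq_top_of_card_eq L h)
    have h2 : Nat.card L ≤ Nat.card H := Subgroup.card_le_card_group L
    have h3 : p ^ l < p ^ n := by rw [← hl, ← hn]; omega
    exact (Nat.pow_lt_pow_iff_right hp.one_lt).mp h3
  obtain ⟨k, rfl⟩ : ∃ k, n = k + 1 := ⟨n - 1, by omega⟩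
  -- Enlarge `L` to a subgroup of index `p`, the smallest prime factor of the order, hence normal
  -- with quotient `ZMod p`.
  obtain ⟨M, hM, hLM⟩ := Sylow.exists_subgroup_card_pow_prime_le (p := p) (n := l) (m := k)
    (by rw [hn]; exact pow_dvd_pow p (by omega)) L hl (by omega)
  have hidx : M.index = p := by
    have := M.card_mul_index
    rw [hM, hn, pow_succ] at this
    exact Nat.eq_of_mul_eq_mul_left (pow_pos hp.pos k) this
  have hN : M.Normal := Subgroup.normal_of_index_eq_minFac_card (by
    rw [hidx, hn, Nat.pow_minFac (by omega), hp.minFac_eq])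
  have hcard : Nat.card (H ⧸ M) = p := hidx
  have hcyc : IsCyclic (H ⧸ M) := isCyclic_of_prime_card hcard
  have hc : Nat.card (Additive (H ⧸ M)) = p := hcard
  subst hc
  let e := zmodAddCyclicAddEquiv (G := Additive (H ⧸ M)) inferInstance
  refine ⟨e.symm.toAddMonoidHom.comp (QuotientGroup.mk' M).toAdditive, fun h0 => ?_, fun h hh => ?_⟩
  · have hMtop : M = ⊤ := by
      rw [eq_top_iff]
      intro x _
      have := DFunLike.congr_fun h0 (Additive.ofMul x)
      simp at this
      exact this
    exact hp.ne_one (hidx.symm.trans (by rw [hMtop, Subgroup.index_top]))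
  · simp
    exact hLM hh

/-- The homomorphisms to `ZMod p` that vanish on a set. -/
def homAnnihilator (p : ℕ) {H : Type*} [Group H] (S : Set H) :
    Submodule (ZMod p) (Additive H →+ ZMod p) where
  carrier := {χ | ∀ h ∈ S, χ (Additive.ofMul h) = 0}
  add_mem' ha hb h hh := by simp [ha h hh, hb h hh]
  zero_mem' h _ := rfl
  smul_mem' c χ hχ h hh := by simp [hχ h hh]

theorem mem_homAnnihilator {p : ℕ} {H : Type*} [Group H] {S : Set H} {χ : Additive H →+ ZMod p} :
    χ ∈ homAnnihilator p S ↔ ∀ h ∈ S, χ (Additive.ofMul h) = 0 := Iff.rfl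

instance finite_hom_zmod {p : ℕ} [NeZero p] {H : Type*} [Group H] [Finite H] :
    Finite (Additive H →+ ZMod p) :=
  Finite.of_injective (fun f (x : Additive H) => f x) DFunLike.coe_injective

/-- Greedy choice: while `S` does not generate, some character kills `S` but not some `x`, and
inserting `x` strictly shrinks the annihilator. A zero annihilator forces generation. -/
theorem IsPGroup.exists_closure_union_eq_top {p : ℕ} [Fact p.Prime] {H : Type*} [Group H] [Finite H]
    (hH : IsPGroup p H) (n : ℕ) (S : Finset H)
    (hS : Module.finrank (ZMod p) (homAnnihilator p (S : Set H)) ≤ n) :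
    ∃ T : Finset H, T.card ≤ S.card + n ∧ Subgroup.closure (T : Set H) = ⊤ := by
  classical
  induction n generalizing S with
  | zero =>
    refine ⟨S, le_rfl, ?_⟩
    by_contra hne
    obtain ⟨χ, hχ, h0⟩ := hH.exists_hom_zmod_ne_zero hne
    have hbot : homAnnihilator p (S : Set H) = ⊥ :=
      Submodule.finrank_eq_zero.mp (Nat.le_zero.mp hS)
    have : χ ∈ homAnnihilator p (S : Set H) := fun h hh => h0 h (Subgroup.subset_closure hh)
    rw [hbot] at this
    exact hχ this
  | succ n ih =>
    by_cases hne : Subgroup.closure (S : Set H) = ⊤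
    · exact ⟨S, by omega, hne⟩
    obtain ⟨χ, hχ, h0⟩ := hH.exists_hom_zmod_ne_zero hne
    obtain ⟨x, hx⟩ : ∃ x : H, χ (Additive.ofMul x) ≠ 0 := by
      by_contra! hall
      exact hχ (DFunLike.ext _ _ hall)
    have hlt : homAnnihilator p ((insert x S : Finset H) : Set H) < homAnnihilator p (S : Set H) := by
      refine lt_of_le_of_ne (fun ψ hψ h hh => hψ h (by simp_all)) fun heq => ?_
      have : χ ∈ homAnnihilator p (S : Set H) := fun h hh => h0 h (Subgroup.subset_closure hh)
      rw [← heq] at this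
      exact hx (this x (by simp))
    obtain ⟨T, hT, hcl⟩ := ih (insert x S) (by
      have := Submodule.finrank_lt_finrank_of_lt hlt
      omega)
    refine ⟨T, hT.trans ?_, hcl⟩
    have := Finset.card_insert_le x S
    omega

/-- A form of the Burnside basis theorem. -/
theorem IsPGroup.pow_rank_le_card_hom {p : ℕ} [Fact p.Prime] {H : Type*} [Group H] [Finite H]
    (hH : IsPGroup p H) : p ^ Group.rank H ≤ Nat.card (Additive H →+ ZMod p) := by
  obtain ⟨T, hT, hcl⟩ := hH.exists_closure_union_eq_top
    (Module.finrank (ZMod p) (Additive H →+ ZMod p)) ∅ (Submodule.finrank_le _)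
  rw [Module.natCard_eq_pow_finrank (K := ZMod p), Nat.card_zmod]
  refine Nat.pow_le_pow_right (Fact.out : p.Prime).pos ((Group.rank_le hcl).trans ?_)
  simpa using hT

/-- The homomorphisms `H → ZMod p` that vanish on `K` number at most the index of `K`. -/
theorem card_homAnnihilator_le_index {p : ℕ} [Fact p.Prime] {H : Type*} [Group H] [Finite H]
    (K : Subgroup H) : Nat.card (homAnnihilator p (K : Set H)) ≤ K.index := by
  let ev : H → Module.Dual (ZMod p) (homAnnihilator p (K : Set H)) := fun h =>
    { toFun := fun χ => χ.1 (Additive.ofMul h)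
      map_add' := fun _ _ => rfl
      map_smul' := fun _ _ => rfl }
  have hev : ∀ a b, ev (a * b) = ev a + ev b := fun a b => by
    ext χ
    exact map_add χ.1 (Additive.ofMul a) (Additive.ofMul b)
  let evHom : Additive H →+ Module.Dual (ZMod p) (homAnnihilator p (K : Set H)) :=
    AddMonoidHom.mk' (fun h => ev h.toMul) fun a b => hev _ _
  let W := AddSubgroup.toZModSubmodule p evHom.range
  -- A character killed by every evaluation is zero, so the evaluations, already a subspace over the
  -- prime field, fill the dual.
  have hW : W = ⊤ := by
    rw [← Subspace.dualCoannihilator_dualAnnihilator_eq (W := W)]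
    have : W.dualCoannihilator = ⊥ := by
      rw [eq_bot_iff]
      intro χ hχ
      rw [Submodule.mem_dualCoannihilator] at hχ
      refine (Submodule.mem_bot _).mpr (Subtype.ext (DFunLike.ext _ _ fun h => ?_))
      exact hχ (evHom h) ⟨h, rfl⟩
    rw [this, Submodule.dualAnnihilator_bot]
  have hsurj : Function.Surjective evHom := fun ξ => by
    have : ξ ∈ W := hW ▸ Submodule.mem_top
    exact this
  let q : H ⧸ K → Module.Dual (ZMod p) (homAnnihilator p (K : Set H)) :=
    Quotient.lift ev (by
      intro a b hab
      rw [← mul_inv_cancel_left a b, hev]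
      have hab : a⁻¹ * b ∈ K := QuotientGroup.leftRel_apply.mp hab
      have : ev (a⁻¹ * b) = 0 := by
        ext χ
        exact χ.2 _ hab
      rw [this, add_zero])
  have hq : Function.Surjective q := fun ξ => by
    obtain ⟨h, rfl⟩ := hsurj ξ
    exact ⟨QuotientGroup.mk h.toMul, rfl⟩
  calc Nat.card (homAnnihilator p (K : Set H))
      = Nat.card (Module.Dual (ZMod p) (homAnnihilator p (K : Set H))) := by
        rw [Module.natCard_eq_pow_finrank (K := ZMod p), Module.natCard_eq_pow_finrank (K := ZMod p) (V := Module.Dual _ _),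
          Subspace.dual_finrank_eq]
    _ ≤ Nat.card (H ⧸ K) := Nat.card_le_card_of_surjective q hq
    _ = K.index := rfl

/-- Restriction of homomorphisms to `ZMod p` to a subgroup. -/
def homRestrict (p : ℕ) {H : Type*} [Group H] (K : Subgroup H) :
    (Additive H →+ ZMod p) →ₗ[ZMod p] (Additive K →+ ZMod p) where
  toFun χ := χ.comp K.subtype.toAdditive
  map_add' _ _ := rfl
  map_smul' _ _ := rfl

theorem ker_homRestrict (p : ℕ) {H : Type*} [Group H] (K : Subgroup H) :
    LinearMap.ker (homRestrict p K) = homAnnihilator p (K : Set H) := by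
  ext χ
  rw [LinearMap.mem_ker, mem_homAnnihilator]
  exact ⟨fun h x hx => DFunLike.congr_fun h (Additive.ofMul ⟨x, hx⟩),
    fun h => DFunLike.ext _ _ fun x => h _ x.toMul.2⟩

/-- Rank-nullity for restriction to `K`, whose kernel is the annihilator of `K`. -/
theorem card_hom_le_index_mul {p : ℕ} [Fact p.Prime] {H : Type*} [Group H] [Finite H]
    (K : Subgroup H) :
    Nat.card (Additive H →+ ZMod p) ≤ K.index * Nat.card (Additive K →+ ZMod p) := by
  have h1 := card_homAnnihilator_le_index (p := p) K
  have h2 := (homRestrict p K).finrank_range_add_finrank_ker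
  rw [ker_homRestrict] at h2
  have h3 := Submodule.finrank_le (LinearMap.range (homRestrict p K))
  rw [Module.natCard_eq_pow_finrank (K := ZMod p), Nat.card_zmod] at h1
  rw [Module.natCard_eq_pow_finrank (K := ZMod p), Nat.card_zmod,
    Module.natCard_eq_pow_finrank (K := ZMod p) (V := Additive K →+ ZMod p), Nat.card_zmod, ← h2,
    pow_add, mul_comm]
  exact Nat.mul_le_mul h1 (Nat.pow_le_pow_right (Fact.out : p.Prime).pos h3)

/-- If the `p`-th power map from `H` to `K = ker α` corresponds under `α` and `β` to a surjective
linear map `V → V'`, then `dim Hom(H, 𝔽_p) - dim Hom(K, 𝔽_p) ≤ dim V - dim V'`. -/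
theorem finrank_hom_add_le {p : ℕ} [Fact p.Prime] {H : Type*} [Group H] [Finite H]
    {V V' : Type*} [AddCommGroup V] [AddCommGroup V'] [Module (ZMod p) V] [Module (ZMod p) V']
    [Finite V] [Finite V'] (α : H →* Multiplicative V) (β : α.ker →* Multiplicative V')
    (m : V →ₗ[ZMod p] V') (hm : Function.Surjective m)
    (hpow : ∀ h : H, ∃ hk : h ^ p ∈ α.ker, (β ⟨h ^ p, hk⟩).toAdd = m (α h).toAdd) :
    Module.finrank (ZMod p) (Additive H →+ ZMod p) + Module.finrank (ZMod p) V' ≤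
      Module.finrank (ZMod p) V + Module.finrank (ZMod p) (Additive α.ker →+ ZMod p) := by
  let αA : Additive H →+ V := MonoidHom.toAdditiveLeft α
  let W : Submodule (ZMod p) V := AddSubgroup.toZModSubmodule p αA.range
  have hker : Module.finrank (ZMod p) (LinearMap.ker (homRestrict p α.ker)) ≤
      Module.finrank (ZMod p) W := by
    have h1 := card_homAnnihilator_le_index (p := p) α.ker
    rw [← ker_homRestrict] at h1
    have h2 : α.ker.index = Nat.card W := by
      rw [Subgroup.index_ker]
      exact Nat.card_congr ⟨fun x => ⟨x.1.toAdd, x.2⟩, fun x => ⟨Multiplicative.ofAdd x.1, x.2⟩,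
        fun _ => rfl, fun _ => rfl⟩
    rw [h2, Module.natCard_eq_pow_finrank (K := ZMod p), Module.natCard_eq_pow_finrank (K := ZMod p) (V := W),
      Nat.card_zmod] at h1
    exact (Nat.pow_le_pow_iff_right (Fact.out : p.Prime).one_lt).mp h1
  -- pull back functionals along `β`
  let βs : Module.Dual (ZMod p) V' →ₗ[ZMod p] (Additive α.ker →+ ZMod p) :=
    { toFun := fun ξ => ξ.toAddMonoidHom.comp (MonoidHom.toAdditiveLeft β)
      map_add' := fun _ _ => rfl
      map_smul' := fun _ _ => rfl }
  obtain ⟨C, hC⟩ := Submodule.exists_isCompl (W.map m).dualAnnihilator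
  -- If `ξ ∘ β` extends to a character `χ` of `H`, then `ξ (m (α h)) = χ (h ^ p) = p χ(h) = 0`. So
  -- on a complement `C` of the annihilator of `m(W)`, `βs` is injective and its image misses the
  -- restricted characters.
  have key : ∀ ξ : Module.Dual (ZMod p) V', βs ξ ∈ LinearMap.range (homRestrict p α.ker) →
      ξ ∈ (W.map m).dualAnnihilator := by
    rintro ξ ⟨χ, hχ⟩
    rw [Submodule.mem_dualAnnihilator]
    rintro _ ⟨_, ⟨h, rfl⟩, rfl⟩
    obtain ⟨hk, he⟩ := hpow h.toMul
    have h1 := DFunLike.congr_fun hχ (Additive.ofMul ⟨_, hk⟩)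
    have h2 : χ (Additive.ofMul (h.toMul ^ p)) = ξ (m (α h.toMul).toAdd) := by
      rw [← he]
      exact h1
    rw [ofMul_pow, map_nsmul, nsmul_eq_mul, CharP.cast_eq_zero, zero_mul] at h2
    exact h2.symm
  have hinj : Disjoint C (LinearMap.ker βs) := by
    rw [Submodule.disjoint_def]
    intro ξ hξ h0
    refine (Submodule.disjoint_def.mp hC.disjoint) ξ (key ξ ?_) hξ
    rw [LinearMap.mem_ker.mp h0]
    exact Submodule.zero_mem _
  have hdisj : Disjoint (LinearMap.range (homRestrict p α.ker)) (C.map βs) := by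
    rw [Submodule.disjoint_def]
    rintro _ hr ⟨ξ, hξ, rfl⟩
    rw [(Submodule.disjoint_def.mp hC.disjoint) ξ (key ξ hr) hξ, map_zero]
  have hCdim : Module.finrank (ZMod p) (C.map βs) = Module.finrank (ZMod p) (W.map m) := by
    have e1 : Module.finrank (ZMod p) (C.map βs) = Module.finrank (ZMod p) C :=
      by
      rw [← LinearMap.range_domRestrict]
      refine LinearMap.finrank_range_of_inj fun x y hxy => Subtype.ext (sub_eq_zero.mp ?_)
      refine (Submodule.disjoint_def.mp hinj) _ (C.sub_mem x.2 y.2) ?_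
      rw [LinearMap.mem_ker, map_sub]
      exact sub_eq_zero.mpr hxy
    have e2 := Submodule.finrank_add_eq_of_isCompl hC
    have e3 := Subspace.finrank_add_finrank_dualAnnihilator_eq (W.map m)
    rw [Subspace.dual_finrank_eq] at e2
    omega
  have h1 := Submodule.finrank_add_finrank_le_of_disjoint hdisj
  have h2 := (homRestrict p α.ker).finrank_range_add_finrank_ker
  have h3 := (m.domRestrict W).finrank_range_add_finrank_ker
  have h4 := m.finrank_range_add_finrank_ker
  rw [LinearMap.range_eq_top.mpr hm, finrank_top] at h4
  rw [LinearMap.range_domRestrict] at h3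
  -- The loss `dim W - dim m(W)` is the dimension of a kernel inside `ker m`, hence at most `dim V -
  -- dim V'`.
  have h5 : Module.finrank (ZMod p) (LinearMap.ker (m.domRestrict W)) ≤
      Module.finrank (ZMod p) (LinearMap.ker m) := by
    refine LinearMap.finrank_le_finrank_of_injective
      (f := W.subtype.restrict (p := LinearMap.ker (m.domRestrict W)) (q := LinearMap.ker m)
        fun x hx => hx) ?_
    intro x y hxy
    exact Subtype.ext (Subtype.ext (congrArg (fun z : LinearMap.ker m => z.1) hxy))
  omega

theorem Module.natCard_eq_zmod_pow_finrank (p : ℕ) [Fact p.Prime] (V : Type*) [AddCommGroup V]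
    [Module (ZMod p) V] [Finite V] : Nat.card V = p ^ Module.finrank (ZMod p) V := by
  rw [Module.natCard_eq_pow_finrank (K := ZMod p), Nat.card_zmod]

theorem card_hom_mul_le {p : ℕ} [Fact p.Prime] {H : Type*} [Group H] [Finite H]
    {V V' : Type*} [AddCommGroup V] [AddCommGroup V'] (hV : ∀ v : V, p • v = 0)
    (hV' : ∀ v : V', p • v = 0)
    [Finite V] [Finite V'] (α : H →* Multiplicative V) (β : α.ker →* Multiplicative V')
    (m : V →+ V') (hm : Function.Surjective m)
    (hpow : ∀ h : H, ∃ hk : h ^ p ∈ α.ker, (β ⟨h ^ p, hk⟩).toAdd = m (α h).toAdd) :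
    Nat.card (Additive H →+ ZMod p) * Nat.card V' ≤
      Nat.card V * Nat.card (Additive α.ker →+ ZMod p) := by
  let _ : Module (ZMod p) V := AddCommGroup.zmodModule hV
  let _ : Module (ZMod p) V' := AddCommGroup.zmodModule hV'
  rw [Module.natCard_eq_zmod_pow_finrank p V', Module.natCard_eq_zmod_pow_finrank p V,
    Module.natCard_eq_zmod_pow_finrank p (Additive H →+ ZMod p),
    Module.natCard_eq_zmod_pow_finrank p (Additive α.ker →+ ZMod p), ← pow_add, ← pow_add]
  exact Nat.pow_le_pow_right (Fact.out : p.Prime).pos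
    (finrank_hom_add_le α β (m.toZModLinearMap p) hm hpow)

/-! ### The subgroups `nR` and the layers `pⁱR / pⁱ⁺¹R`. -/

/-- The subgroup `nR` of an additive commutative group `R`. -/
def nsmulRange (R : Type*) [AddCommGroup R] (n : ℕ) : AddSubgroup R :=
  (nsmulAddMonoidHom n : R →+ R).range

theorem nsmulRange_le_of_dvd {R : Type*} [AddCommGroup R] {m n : ℕ} (h : m ∣ n) :
    nsmulRange R n ≤ nsmulRange R m := by
  obtain ⟨k, rfl⟩ := h
  rintro _ ⟨y, rfl⟩
  exact ⟨k • y, (mul_nsmul' y m k).symm⟩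

theorem mul_mem_nsmulRange {R : Type*} [NonUnitalRing R] {m n : ℕ} {x y : R}
    (hx : x ∈ nsmulRange R m) (hy : y ∈ nsmulRange R n) : x * y ∈ nsmulRange R (m * n) := by
  obtain ⟨a, rfl⟩ := hx
  obtain ⟨b, rfl⟩ := hy
  refine ⟨a * b, ?_⟩
  simp only [nsmulAddMonoidHom_apply]
  rw [smul_mul_smul_comm]

theorem mul_mem_nsmulRange_left {R : Type*} [NonUnitalRing R] {m : ℕ} {x : R}
    (hx : x ∈ nsmulRange R m) (y : R) : x * y ∈ nsmulRange R m := by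
  obtain ⟨a, rfl⟩ := hx
  exact ⟨a * y, (smul_mul_assoc m a y).symm⟩

theorem mul_mem_nsmulRange_right {R : Type*} [NonUnitalRing R] {m : ℕ} {x : R}
    (hx : x ∈ nsmulRange R m) (y : R) : y * x ∈ nsmulRange R m := by
  obtain ⟨a, rfl⟩ := hx
  exact ⟨y * a, (mul_smul_comm m y a).symm⟩

/-- The layer `pⁱR / pⁱ⁺¹R`. -/
abbrev PowLayer (R : Type*) [AddCommGroup R] (p i : ℕ) : Type _ :=
  nsmulRange R (p ^ i) ⧸ (nsmulRange R (p ^ (i + 1))).addSubgroupOf (nsmulRange R (p ^ i))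

namespace PowLayer

variable {R : Type*} [AddCommGroup R] {p i : ℕ}

/-- The class in the layer of an element of `pⁱR`. -/
abbrev mk (x : nsmulRange R (p ^ i)) : PowLayer R p i := QuotientAddGroup.mk x

theorem mk_eq_zero {x : nsmulRange R (p ^ i)} :
    mk x = 0 ↔ (x : R) ∈ nsmulRange R (p ^ (i + 1)) := by
  rw [QuotientAddGroup.eq_zero_iff, AddSubgroup.mem_addSubgroupOf]

theorem mk_eq_mk {x y : nsmulRange R (p ^ i)} :
    mk x = mk y ↔ (x : R) - y ∈ nsmulRange R (p ^ (i + 1)) := by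
  rw [← sub_eq_zero]
  exact mk_eq_zero (x := x - y)

theorem nsmul_eq_zero (v : PowLayer R p i) : p • v = 0 := by
  obtain ⟨⟨_, y, rfl⟩, rfl⟩ := QuotientAddGroup.mk_surjective v
  refine mk_eq_zero.mpr ⟨y, ?_⟩
  simp only [nsmulAddMonoidHom_apply, AddSubgroup.coe_nsmul]
  rw [← mul_nsmul, pow_succ]

/-- Multiplication by `p` from `pⁱR` to `pⁱ⁺¹R`. -/
def nsmulHom (R : Type*) [AddCommGroup R] (p i : ℕ) :
    nsmulRange R (p ^ i) →+ nsmulRange R (p ^ (i + 1)) :=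
  ((nsmulAddMonoidHom p).comp (nsmulRange R (p ^ i)).subtype).codRestrict _ (by
    rintro ⟨_, y, rfl⟩
    refine ⟨y, ?_⟩
    simp only [nsmulAddMonoidHom_apply, AddMonoidHom.comp_apply, AddSubgroup.subtype_apply]
    rw [← mul_nsmul, pow_succ])

theorem coe_nsmulHom (x : nsmulRange R (p ^ i)) : (nsmulHom R p i x : R) = p • (x : R) := rfl

/-- Multiplication by `p` from each layer to the next. -/
def mulP (R : Type*) [AddCommGroup R] (p i : ℕ) : PowLayer R p i →+ PowLayer R p (i + 1) :=
  QuotientAddGroup.map _ _ (nsmulHom R p i) (by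
    intro x hx
    obtain ⟨y, hy⟩ := AddSubgroup.mem_addSubgroupOf.mp hx
    rw [AddSubgroup.mem_comap, AddSubgroup.mem_addSubgroupOf, coe_nsmulHom, ← hy]
    refine ⟨y, ?_⟩
    simp only [nsmulAddMonoidHom_apply]
    rw [← mul_nsmul, pow_succ])

theorem mulP_surjective : Function.Surjective (mulP R p i) := by
  intro v
  obtain ⟨⟨_, y, rfl⟩, rfl⟩ := QuotientAddGroup.mk_surjective v
  refine ⟨mk ⟨_, y, rfl⟩, congrArg mk (Subtype.ext ?_)⟩
  rw [coe_nsmulHom]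
  simp only [nsmulAddMonoidHom_apply]
  rw [← mul_nsmul, pow_succ]

/-- Each layer maps onto the next by multiplication by `p`, and layer `0` is `R / pR`. -/
theorem card_le [Finite R] (p i : ℕ) : Nat.card (PowLayer R p i) ≤ (nsmulRange R p).index := by
  induction i with
  | zero =>
    have h : nsmulRange R (p ^ 0) = ⊤ := by
      rw [eq_top_iff]
      exact fun x _ => ⟨x, by simp⟩
    change (nsmulRange R (p ^ (0 + 1))).relIndex (nsmulRange R (p ^ 0)) ≤ _
    rw [h, AddSubgroup.relIndex_top_right, zero_add, pow_one]
  | succ i ih => exact (Nat.card_le_card_of_surjective _ mulP_surjective).trans ih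

end PowLayer

theorem index_nsmulRange_pow_le {R : Type*} [AddCommGroup R] [Finite R] (p i : ℕ) :
    (nsmulRange R (p ^ i)).index ≤ (nsmulRange R p).index ^ i := by
  induction i with
  | zero =>
    have h : nsmulRange R (p ^ 0) = ⊤ := by
      rw [eq_top_iff]
      exact fun x _ => ⟨x, by simp⟩
    rw [h]
    simp
  | succ i ih =>
    rw [← AddSubgroup.relIndex_mul_index (nsmulRange_le_of_dvd (pow_dvd_pow p i.le_succ)),
      pow_succ' (nsmulRange R p).index]
    exact Nat.mul_le_mul (PowLayer.card_le p i) ih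

/-! ### Adjoint homomorphisms and `p`-th powers. -/

/-- A homomorphism from a group to the adjoint monoid of a ring, whose operation is
`(x, y) ↦ x + y + x * y`. -/
structure AdjointHom (A R : Type*) [Group A] [NonUnitalRing R] where
  /-- The underlying function. -/
  toFun : A → R
  map_one' : toFun 1 = 0
  map_mul' : ∀ a b, toFun (a * b) = toFun a + toFun b + toFun a * toFun b

namespace AdjointHom

variable {A R : Type*} [Group A] [NonUnitalRing R]

instance : CoeFun (AdjointHom A R) fun _ => A → R := ⟨toFun⟩

variable (φ : AdjointHom A R)

theorem map_one : φ 1 = 0 := φ.map_one'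

theorem map_mul (a b : A) : φ (a * b) = φ a + φ b + φ a * φ b := φ.map_mul' a b

/-- Restriction to a subgroup. -/
def restrict (H : Subgroup A) : AdjointHom H R where
  toFun h := φ h
  map_one' := φ.map_one
  map_mul' a b := φ.map_mul a b

theorem restrict_injective (hφ : Function.Injective φ) (H : Subgroup A) :
    Function.Injective (φ.restrict H) := fun _ _ h => Subtype.ext (hφ h)

/-- The binomial expansion of `(1 + φ a) ^ k`, cut after the quadratic term. -/
theorem map_pow_of_mem {n : ℕ} {a : A} (ha : φ a ∈ nsmulRange R n) (k : ℕ) :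
    ∃ z ∈ nsmulRange R (n * n * n), φ (a ^ k) = k • φ a + k.choose 2 • (φ a * φ a) + z := by
  induction k with
  | zero => exact ⟨0, zero_mem _, by simp [map_one]⟩
  | succ k ih =>
    obtain ⟨z, hz, h⟩ := ih
    refine ⟨z + k.choose 2 • (φ a * φ a * φ a) + z * φ a, ?_, ?_⟩
    · exact add_mem (add_mem hz (nsmul_mem
        (mul_mem_nsmulRange (mul_mem_nsmulRange ha ha) ha) _)) (mul_mem_nsmulRange_left hz _)
    · rw [pow_succ, map_mul, h, Nat.choose_succ_succ' k 1, Nat.choose_one_right]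
      simp only [add_mul, smul_mul_assoc, add_smul, one_smul]
      abel

/-- The quadratic term decides which `i` are allowed: for odd `p` the binomial coefficient supplies
a factor `p` and `2i + 1 ≥ i + 2` suffices, while for `p = 2` the bound `2i ≥ i + 2` is used. The
cubic remainder needs only `3i ≥ i + 2`. -/
theorem map_pow_prime_sub_mem {p i : ℕ} (hp : p.Prime) (hi : 1 ≤ i) (h2 : p = 2 → 2 ≤ i) {a : A}
    (ha : φ a ∈ nsmulRange R (p ^ i)) : φ (a ^ p) - p • φ a ∈ nsmulRange R (p ^ (i + 2)) := by
  obtain ⟨z, hz, h⟩ := φ.map_pow_of_mem ha p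
  have e : φ (a ^ p) - p • φ a = p.choose 2 • (φ a * φ a) + z := by
    rw [h]
    abel
  rw [e]
  refine add_mem ?_ ?_
  · have hsq := mul_mem_nsmulRange ha ha
    rw [← pow_add] at hsq
    by_cases hp2 : p = 2
    · exact nsmul_mem (nsmulRange_le_of_dvd (pow_dvd_pow p (by have := h2 hp2; omega)) hsq) _
    · obtain ⟨c, hc⟩ := hp.dvd_choose_self two_ne_zero (lt_of_le_of_ne hp.two_le (Ne.symm hp2))
      obtain ⟨y, hy⟩ := hsq
      have : p.choose 2 • (φ a * φ a) ∈ nsmulRange R (p ^ (i + i + 1)) := by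
        refine ⟨c • y, ?_⟩
        rw [← hy, hc]
        simp only [nsmulAddMonoidHom_apply, ← mul_nsmul]
        congr 1
        ring
      exact nsmulRange_le_of_dvd (pow_dvd_pow p (by omega)) this
  · refine nsmulRange_le_of_dvd ?_ hz
    rw [← pow_add, ← pow_add]
    exact pow_dvd_pow p (by omega)

/-- The homomorphism induced by `φ` to a layer `pⁱR / pⁱ⁺¹R` with `1 ≤ i`. -/
def layerHom {p i : ℕ} (hi : 1 ≤ i) (h : ∀ a, φ a ∈ nsmulRange R (p ^ i)) :
    A →* Multiplicative (PowLayer R p i) :=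
  MonoidHom.mk' (fun a => Multiplicative.ofAdd (PowLayer.mk ⟨φ a, h a⟩)) fun a b => by
    rw [← ofAdd_add]
    refine congrArg Multiplicative.ofAdd (PowLayer.mk_eq_mk
      (y := ⟨φ a, h a⟩ + ⟨φ b, h b⟩) |>.mpr ?_)
    have e : φ (a * b) - (φ a + φ b) = φ a * φ b := by rw [map_mul, add_sub_cancel_left]
    rw [AddSubgroup.coe_add]
    refine e ▸ ?_
    have := mul_mem_nsmulRange (h a) (h b)
    rw [← pow_add] at this
    exact nsmulRange_le_of_dvd (pow_dvd_pow p (by omega)) this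

theorem mem_ker_layerHom {p i : ℕ} (hi : 1 ≤ i) (h : ∀ a, φ a ∈ nsmulRange R (p ^ i)) {a : A} :
    a ∈ (φ.layerHom hi h).ker ↔ φ a ∈ nsmulRange R (p ^ (i + 1)) :=
  PowLayer.mk_eq_zero (x := ⟨φ a, h a⟩)

/-- The elements mapped into `nR`. -/
def comapNsmulRange (n : ℕ) : Subgroup A where
  carrier := {a | φ a ∈ nsmulRange R n}
  one_mem' := by
    rw [Set.mem_ofPred, map_one]
    exact zero_mem _
  mul_mem' {a b} ha hb := by
    rw [Set.mem_ofPred, map_mul]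
    exact add_mem (add_mem ha hb) (mul_mem_nsmulRange_left ha _)
  inv_mem' {a} ha := by
    have h := φ.map_mul a a⁻¹
    rw [mul_inv_cancel, map_one] at h
    have : φ a⁻¹ = -(φ a + φ a * φ a⁻¹) := by
      rw [eq_neg_iff_add_eq_zero, h]
      abel
    rw [Set.mem_ofPred, this]
    exact neg_mem (add_mem ha (mul_mem_nsmulRange_left ha _))

theorem mem_comapNsmulRange {n : ℕ} {a : A} : a ∈ φ.comapNsmulRange n ↔ φ a ∈ nsmulRange R n :=
  Iff.rfl

theorem index_comapNsmulRange_le [Finite R] (n : ℕ) :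
    (φ.comapNsmulRange n).index ≤ (nsmulRange R n).index := by
  refine Nat.card_le_card_of_injective
    (fun q : A ⧸ φ.comapNsmulRange n => (QuotientAddGroup.mk (φ q.out) : R ⧸ nsmulRange R n)) ?_
  intro q r hqr
  rw [← q.out_eq', ← r.out_eq', QuotientGroup.eq, mem_comapNsmulRange]
  have h : -φ q.out + φ r.out ∈ nsmulRange R n := QuotientAddGroup.eq.mp hqr
  -- With `1 + φ` multiplicative, `φ (a⁻¹ b) = (1 + φ a⁻¹)(φ b - φ a)`.
  have e : φ (q.out⁻¹ * r.out) = (-φ q.out + φ r.out) + φ q.out⁻¹ * (-φ q.out + φ r.out) := by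
    have h1 := φ.map_mul q.out⁻¹ q.out
    rw [inv_mul_cancel, map_one] at h1
    have h2 : φ q.out⁻¹ = -(φ q.out + φ q.out⁻¹ * φ q.out) := by
      rw [eq_neg_iff_add_eq_zero, h1]
      abel
    rw [map_mul, mul_add, mul_neg]
    nth_rewrite 1 [h2]
    abel
  rw [e]
  exact add_mem h (mul_mem_nsmulRange_right h _)

/-- A finite `p`-group embedded in the adjoint group of `pⁱR` has at most as many homomorphisms to
`ZMod p` as `pⁱR / pⁱ⁺¹R` has elements. -/
theorem card_hom_le_card_layer [Finite R] {p : ℕ} [Fact p.Prime] {N : ℕ} {A : Type*} [Group A]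
    [Finite A] (φ : AdjointHom A R) (hN : ∀ a, φ a ∈ nsmulRange R (p ^ N) → a = 1) {i : ℕ}
    (hi : 1 ≤ i) (h2 : p = 2 → 2 ≤ i) (h : ∀ a, φ a ∈ nsmulRange R (p ^ i)) :
    Nat.card (Additive A →+ ZMod p) ≤ Nat.card (PowLayer R p i) := by
  by_cases hiN : N ≤ i
  · have htriv : ∀ a : A, a = 1 := fun a =>
      hN a (nsmulRange_le_of_dvd (pow_dvd_pow p hiN) (h a))
    have : Subsingleton (Additive A →+ ZMod p) :=
      ⟨fun f g => DFunLike.ext _ _ fun x => by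
        rw [show x = 0 from htriv x.toMul, map_zero, map_zero]⟩
    calc Nat.card (Additive A →+ ZMod p) ≤ 1 := Finite.card_le_one_iff_subsingleton.mpr this
      _ ≤ _ := Nat.card_pos
  -- Induction towards `N`: passing from `K` to `A`, the dimension of the character space grows by
  -- at most the drop between consecutive layers.
  · let K := (φ.layerHom hi h).ker
    have hK : ∀ a : K, φ.restrict K a ∈ nsmulRange R (p ^ (i + 1)) := fun a =>
      (φ.mem_ker_layerHom hi h).mp a.2
    have ih := card_hom_le_card_layer (φ.restrict K) (N := N)
      (fun a ha => Subtype.ext (hN a ha)) (i := i + 1) (by omega) (fun hp => by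
        have := h2 hp; omega) hK
    have step := card_hom_mul_le (p := p) PowLayer.nsmul_eq_zero PowLayer.nsmul_eq_zero
      (φ.layerHom hi h) ((φ.restrict K).layerHom (by omega) hK) (PowLayer.mulP R p i)
      PowLayer.mulP_surjective (fun a => by
        have hsub := φ.map_pow_prime_sub_mem Fact.out hi h2 (h a)
        have hpa : p • φ a ∈ nsmulRange R (p ^ (i + 1)) :=
          (PowLayer.nsmulHom R p i ⟨φ a, h a⟩).2
        refine ⟨(φ.mem_ker_layerHom hi h).mpr ?_, PowLayer.mk_eq_mk.mpr hsub⟩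
        have := add_mem (nsmulRange_le_of_dvd (pow_dvd_pow p (by omega)) hsub) hpa
        rwa [sub_add_cancel] at this)
    have := step.trans (Nat.mul_le_mul_left _ ih)
    exact Nat.le_of_mul_le_mul_right this Nat.card_pos
termination_by N - i

theorem pow_rank_le [Finite R] {p : ℕ} [Fact p.Prime] {N : ℕ} [Finite A] (hA : IsPGroup p A)
    (hN : ∀ a, φ a ∈ nsmulRange R (p ^ N) → a = 1) {i : ℕ} (hi : 1 ≤ i) (h2 : p = 2 → 2 ≤ i) :
    p ^ Group.rank A ≤ (nsmulRange R p).index ^ (i + 1) := by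
  let K := φ.comapNsmulRange (p ^ i)
  have h1 := card_hom_le_card_layer (φ.restrict K) (N := N) (fun a ha => Subtype.ext (hN a ha))
    hi h2 fun a => a.2
  calc p ^ Group.rank A ≤ Nat.card (Additive A →+ ZMod p) := hA.pow_rank_le_card_hom
    _ ≤ K.index * Nat.card (Additive K →+ ZMod p) := card_hom_le_index_mul K
    _ ≤ (nsmulRange R p).index ^ i * (nsmulRange R p).index :=
      Nat.mul_le_mul ((φ.index_comapNsmulRange_le _).trans (index_nsmulRange_pow_le p i))
        (h1.trans (PowLayer.card_le p i))
    _ = _ := (pow_succ _ _).symm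

end AdjointHom

/-! ### Nilpotent elements and normality of Sylow subgroups. -/

/-- Each further `m`-th power, via `(1 + e) ^ m = 1 + m e + c e²`, raises the order in `x` of the
part not divisible by `m`. -/
theorem exists_one_add_pow_pow_eq {C : Type*} [CommRing C] (x : C) (m k : ℕ) :
    ∃ P Q : C, (1 + x) ^ m ^ k = 1 + m * (x * P) + x ^ (k + 1) * Q := by
  induction k with
  | zero => exact ⟨0, 1, by ring⟩
  | succ k ih =>
    obtain ⟨P, Q, h⟩ := ih
    obtain ⟨c, hc⟩ := Polynomial.powAddExpansion 1 (m * (x * P) + x ^ (k + 1) * Q) m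
    refine ⟨m * P + x ^ k * Q + c * (m * x * P * P + 2 * P * x ^ (k + 1) * Q),
      x ^ k * Q * Q * c, ?_⟩
    rw [pow_succ m k, pow_mul, h, add_assoc, hc]
    ring

/-- Only powers of `x` occur, so the identity is taken in `ℤ[X]` and evaluated at `x`. -/
theorem exists_one_add_pow_pow_eq_of_ring {E : Type*} [Ring E] (x : E) (m k : ℕ) :
    ∃ P Q : E, (1 + x) ^ m ^ k = 1 + m * (x * P) + x ^ (k + 1) * Q := by
  obtain ⟨P, Q, h⟩ := exists_one_add_pow_pow_eq (Polynomial.X : Polynomial ℤ) m k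
  refine ⟨Polynomial.aeval x P, Polynomial.aeval x Q, ?_⟩
  simpa using congrArg (Polynomial.aeval x) h

namespace AdjointHom

variable {A R : Type*} [Group A] [NonUnitalRing R] (φ : AdjointHom A R)

theorem eq_one_of_map_eq_zero (hφ : Function.Injective φ) {a : A} (h : φ a = 0) : a = 1 :=
  hφ (h.trans φ.map_one.symm)

/-- The multiplicative map `a ↦ 1 + φ a` to the unitization. -/
def toUnitization : A →* Unitization ℤ R where
  toFun a := 1 + (φ a : Unitization ℤ R)
  map_one' := by rw [map_one, Unitization.inr_zero, add_zero]
  map_mul' a b := by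
    rw [map_mul, Unitization.inr_add, Unitization.inr_add, Unitization.inr_mul]
    noncomm_ring

theorem toUnitization_apply (a : A) : φ.toUnitization a = 1 + (φ a : Unitization ℤ R) := rfl

theorem exists_map_pow_pow_eq {a : A} (ha : IsNilpotent (φ a : Unitization ℤ R)) (m : ℕ) :
    ∃ k, ∃ g : R, φ (a ^ m ^ k) = m • g ∧ ∀ n : ℕ, n • φ a = 0 → n • g = 0 := by
  obtain ⟨k, hk⟩ := ha
  obtain ⟨u, Q, h⟩ := exists_one_add_pow_pow_eq_of_ring (φ a : Unitization ℤ R) m k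
  rw [pow_succ, hk, zero_mul, zero_mul, add_zero, ← toUnitization_apply, ← map_pow,
    toUnitization_apply, add_left_cancel_iff] at h
  -- This is `φ a * u` computed in the unitization; the left factor `φ a` makes it inherit the
  -- torsion of `φ a`.
  refine ⟨k, u.fst • φ a + φ a * u.snd, ?_, fun n hn => ?_⟩
  · have := congrArg (fun v : Unitization ℤ R => v.snd) h
    rw [Unitization.snd_inr, ← nsmul_eq_mul, Unitization.snd_smul, Unitization.snd_mul] at this
    simpa using this
  · rw [nsmul_add, smul_comm, hn, smul_zero, zero_add, ← smul_mul_assoc, hn, zero_mul]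

/-- The elements `a` with `n • φ a = 0`. -/
def torsion (n : ℕ) : Subgroup A where
  carrier := {a | n • φ a = 0}
  one_mem' := by rw [Set.mem_ofPred, map_one, smul_zero]
  mul_mem' {a b} ha hb := by
    rw [Set.mem_ofPred] at *
    rw [map_mul, nsmul_add, nsmul_add, ← smul_mul_assoc, ha, hb, zero_mul, add_zero, add_zero]
  inv_mem' {a} ha := by
    rw [Set.mem_ofPred] at *
    have h := φ.map_mul a a⁻¹
    rw [mul_inv_cancel, map_one] at h
    have h2 := congrArg (n • ·) h
    simp only [nsmul_add, smul_zero] at h2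
    rw [← smul_mul_assoc, ha, zero_mul, zero_add, add_zero] at h2
    exact h2.symm

theorem mem_torsion {n : ℕ} {a : A} : a ∈ φ.torsion n ↔ n • φ a = 0 := Iff.rfl

theorem torsion_normal (n : ℕ) : (φ.torsion n).Normal where
  conj_mem a ha b := by
    rw [mem_torsion] at *
    have h := φ.map_mul b b⁻¹
    rw [mul_inv_cancel, map_one] at h
    have e : φ (b * a * b⁻¹) = (φ a + φ b * φ a) + (φ a + φ b * φ a) * φ b⁻¹ := by
      rw [map_mul, map_mul]
      have : (φ b + φ a + φ b * φ a) + φ b⁻¹ + (φ b + φ a + φ b * φ a) * φ b⁻¹ =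
          (φ b + φ b⁻¹ + φ b * φ b⁻¹) + ((φ a + φ b * φ a) + (φ a + φ b * φ a) * φ b⁻¹) := by
        simp only [add_mul]
        abel
      rw [this, ← h, zero_add]
    have ht : n • (φ a + φ b * φ a) = 0 := by
      rw [nsmul_add, ← mul_smul_comm, ha, mul_zero, add_zero]
    rw [e, nsmul_add, ← smul_mul_assoc, ht, zero_mul, add_zero]

variable {φ}

theorem isPGroup_torsion (hφ : Function.Injective φ)
    (hnil : ∀ r : R, IsNilpotent (r : Unitization ℤ R)) (p N : ℕ) :
    IsPGroup p (φ.torsion (p ^ N)) := by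
  rintro ⟨a, ha⟩
  obtain ⟨k, g, hg, hn⟩ := φ.exists_map_pow_pow_eq (hnil (φ a)) (p ^ N)
  refine ⟨N * k, Subtype.ext (φ.eq_one_of_map_eq_zero hφ ?_)⟩
  change φ (a ^ p ^ (N * k)) = 0
  rw [pow_mul, hg, hn _ ha]

/-- A Sylow `p`-subgroup is the normal subgroup of elements with `φ a` killed by `p ^ N`, the
`p`-part of `|R|`: that subgroup is a `p`-group, and it contains `a ∈ P` because it contains `a ^ m
^ k`, of which `a` is a power. -/
theorem sylow_normal [Finite A] [Finite R] (hφ : Function.Injective φ)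
    (hnil : ∀ r : R, IsNilpotent (r : Unitization ℤ R)) {p : ℕ} [hp : Fact p.Prime]
    (P : Sylow p A) : (P : Subgroup A).Normal := by
  obtain ⟨N, m, hm, hcard⟩ := Nat.exists_eq_pow_mul_and_not_dvd
    (Nat.card_pos (α := R)).ne' p hp.out.ne_one
  have hle : (P : Subgroup A) ≤ φ.torsion (p ^ N) := by
    intro a ha
    obtain ⟨k, g, hg, -⟩ := φ.exists_map_pow_pow_eq (hnil (φ a)) m
    have h1 : a ^ m ^ k ∈ φ.torsion (p ^ N) := by
      rw [mem_torsion, hg, ← mul_nsmul', ← hcard, card_nsmul_eq_zero']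
    obtain ⟨b, hb⟩ := P.isPGroup' ⟨a, ha⟩
    have hb : a ^ p ^ b = 1 := congrArg Subtype.val hb
    have hco : (m ^ k).Coprime (p ^ b) :=
      (((Nat.Prime.coprime_iff_not_dvd hp.out).mpr hm).symm).pow k b
    obtain ⟨c, hc⟩ := exists_pow_eq_self_of_coprime
      (hco.coprime_dvd_right (orderOf_dvd_of_pow_eq_one hb))
    rw [← hc]
    exact pow_mem h1 c
  have := P.is_maximal' (isPGroup_torsion hφ hnil p N) hle
  have e : (P : Subgroup A) = φ.torsion (p ^ N) := this.symm
  rw [e]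
  exact φ.torsion_normal _

theorem exists_eq_one_of_mem_nsmulRange [Finite R] (hφ : Function.Injective φ)
    (hnil : ∀ r : R, IsNilpotent (r : Unitization ℤ R)) {p : ℕ} [hp : Fact p.Prime]
    (hA : IsPGroup p A) : ∃ N : ℕ, ∀ a, φ a ∈ nsmulRange R (p ^ N) → a = 1 := by
  obtain ⟨N, m, hm, hcard⟩ := Nat.exists_eq_pow_mul_and_not_dvd
    (Nat.card_pos (α := R)).ne' p hp.out.ne_one
  refine ⟨N, fun a ⟨y, hy⟩ => ?_⟩
  obtain ⟨k, g, hg, hn⟩ := φ.exists_map_pow_pow_eq (hnil (φ a)) m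
  have h1 : a ^ m ^ k = 1 := φ.eq_one_of_map_eq_zero hφ (by
    rw [hg]
    refine hn m ?_
    rw [← hy, nsmulAddMonoidHom_apply, ← mul_nsmul, ← hcard, card_nsmul_eq_zero'])
  obtain ⟨b, hb⟩ := hA a
  have hco : (m ^ k).Coprime (p ^ b) :=
    (((Nat.Prime.coprime_iff_not_dvd hp.out).mpr hm).symm).pow k b
  have := pow_gcd_eq_one.mpr ⟨h1, hb⟩
  rwa [hco.gcd_eq_one, pow_one] at this

end AdjointHom

/-! ### Reduction of the rank to Sylow subgroups. -/

theorem Group.exists_fin_generators {G : Type*} [Group G] [Group.FG G] {B : ℕ}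
    (h : Group.rank G ≤ B) : ∃ g : Fin B → G, Subgroup.closure (Set.range g) = ⊤ := by
  obtain ⟨S, hS, hcl⟩ := Group.rank_spec G
  refine ⟨fun j => if hj : j.1 < S.card then S.equivFin.symm ⟨j, hj⟩ else 1, ?_⟩
  rw [eq_top_iff, ← hcl]
  refine Subgroup.closure_mono fun s hs => ?_
  have hlt := (S.equivFin ⟨s, hs⟩).2
  exact ⟨⟨S.equivFin ⟨s, hs⟩, by omega⟩, by simp⟩

theorem Group.rank_pi_le_of_coprime {ι : Type*} [Finite ι] {G : ι → Type*} [∀ i, Group (G i)]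
    [∀ i, Finite (G i)] (hco : Pairwise fun i j => (Nat.card (G i)).Coprime (Nat.card (G j)))
    {B : ℕ} (h : ∀ i, Group.rank (G i) ≤ B) : Group.rank (∀ i, G i) ≤ B := by
  classical
  have := Fintype.ofFinite ι
  choose g hg using fun i => Group.exists_fin_generators (h i)
  let x : Fin B → ∀ i, G i := fun j i => g i j
  have hcl : Subgroup.closure ((Finset.univ.image x : Finset (∀ i, G i)) : Set (∀ i, G i)) = ⊤ := by
    rw [Finset.coe_image, Finset.coe_univ, Set.image_univ]
    set L := Subgroup.closure (Set.range x)
    have hsingle : ∀ i, ∀ y : G i, Pi.mulSingle i y ∈ L := by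
      intro i y
      have hle : Subgroup.closure (Set.range (g i)) ≤ L.comap (MonoidHom.mulSingle G i) := by
        rw [Subgroup.closure_le]
        rintro _ ⟨j, rfl⟩
        have hc : (Nat.card (G i)).Coprime (∏ k ∈ Finset.univ.erase i, Nat.card (G k)) :=
          Nat.Coprime.prod_right fun k hk => hco (Finset.ne_of_mem_erase hk).symm
        -- The `n`-th power fixes coordinate `i` and kills all others, so one diagonal tuple serves
        -- every factor at once.
        obtain ⟨n, hn1, hn0⟩ := Nat.chineseRemainder hc 1 0
        have e : MonoidHom.mulSingle G i (g i j) = x j ^ n := by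
          ext k
          rw [Pi.pow_apply, MonoidHom.mulSingle_apply]
          by_cases hk : k = i
          · subst hk
            rw [Pi.mulSingle_eq_same]
            have := pow_eq_pow_of_modEq hn1 (pow_card_eq_one' (x := g k j))
            rw [pow_one] at this
            exact this.symm
          · rw [Pi.mulSingle_eq_of_ne hk]
            have hd : Nat.card (G k) ∣ n :=
              (Finset.dvd_prod_of_mem (fun k => Nat.card (G k))
                (Finset.mem_erase.mpr ⟨hk, Finset.mem_univ k⟩)).trans
                (Nat.modEq_zero_iff_dvd.mp hn0)
            obtain ⟨c, rfl⟩ := hd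
            rw [pow_mul, pow_card_eq_one', one_pow]
        change MonoidHom.mulSingle G i (g i j) ∈ L
        rw [e]
        exact pow_mem (Subgroup.subset_closure (Set.mem_range_self j)) n
      rw [hg i] at hle
      exact hle (Subgroup.mem_top y)
    exact eq_top_iff.mpr fun y _ => Subgroup.pi_mem_of_mulSingle_mem y fun i => hsingle i _
  exact (Group.rank_le hcl).trans (Finset.card_image_le.trans (by simp))

theorem Group.rank_le_of_sylow {G : Type*} [Group G] [Finite G]
    (hn : ∀ {p : ℕ} [Fact p.Prime] (P : Sylow p G), (P : Subgroup G).Normal) {B : ℕ}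
    (h : ∀ (p : ℕ) [Fact p.Prime] (P : Sylow p G), Group.rank P ≤ B) : Group.rank G ≤ B := by
  have e := Sylow.directProductOfNormal hn
  have hpr : ∀ p : (Nat.card G).primeFactors, Fact (p : ℕ).Prime := fun p =>
    ⟨Nat.prime_of_mem_primeFactors p.2⟩
  rw [← Group.rank_congr e]
  refine Group.rank_pi_le_of_coprime (fun p q hpq => ?_) fun p => ?_
  · have hpow : ∀ r : (Nat.card G).primeFactors, ∃ n,
        Nat.card (∀ P : Sylow (r : ℕ) G, P) = (r : ℕ) ^ n := fun r => by
      have := Fintype.ofFinite (Sylow (r : ℕ) G)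
      choose n hn using fun P : Sylow (r : ℕ) G => IsPGroup.iff_card.mp P.isPGroup'
      refine ⟨∑ P, n P, ?_⟩
      rw [Nat.card_pi, ← Finset.prod_pow_eq_pow_sum]
      exact Finset.prod_congr rfl fun P _ => hn P
    obtain ⟨n, hn⟩ := hpow p
    obtain ⟨k, hk⟩ := hpow q
    change (Nat.card _).Coprime (Nat.card _)
    rw [hn, hk]
    exact Nat.Coprime.pow n k ((Nat.coprime_primes (hpr p).out (hpr q).out).mpr
      fun h => hpq (Subtype.ext h))
  · refine Group.rank_pi_le_of_coprime (fun P Q hPQ => ?_) fun P => h _ P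
    have := Sylow.unique_of_normal P (hn P)
    exact absurd (Subsingleton.elim P Q) hPQ

theorem AdjointHom.rank_le {A R : Type*} [Group A] [NonUnitalRing R] [Finite A] [Finite R]
    {φ : AdjointHom A R} (hφ : Function.Injective φ)
    (hnil : ∀ r : R, IsNilpotent (r : Unitization ℤ R)) {B : ℕ}
    (h : ∀ p : ℕ, p.Prime → ∃ i, 1 ≤ i ∧ (p = 2 → 2 ≤ i) ∧
      (nsmulRange R p).index ^ (i + 1) ≤ p ^ B) : Group.rank A ≤ B := by
  refine Group.rank_le_of_sylow (sylow_normal hφ hnil) fun p hp P => ?_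
  obtain ⟨i, hi, h2, hB⟩ := h p hp.out
  have hφP := φ.restrict_injective hφ (P : Subgroup A)
  obtain ⟨N, hN⟩ := exists_eq_one_of_mem_nsmulRange hφP hnil P.isPGroup'
  have := ((φ.restrict (P : Subgroup A)).pow_rank_le P.isPGroup' hN hi h2).trans hB
  exact (Nat.pow_le_pow_iff_right hp.out.one_lt).mp this

/-! ### Bounding `|R : pR|` by generators. -/

theorem card_le_pow_card_of_closure_eq_top {p : ℕ} [Fact p.Prime] {V : Type*} [AddCommGroup V]
    [Module (ZMod p) V] [Finite V] {S : Finset V} (hS : AddSubgroup.closure (S : Set V) = ⊤) :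
    Nat.card V ≤ p ^ S.card := by
  have hspan : Submodule.span (ZMod p) (S : Set V) = ⊤ := by
    refine (Submodule.toAddSubgroup_injective (eq_top_iff.mpr ?_))
    rw [← hS, AddSubgroup.closure_le]
    exact Submodule.subset_span
  have h := finrank_span_finset_le_card (R := ZMod p) S
  rw [Set.finrank, hspan, finrank_top] at h
  rw [Module.natCard_eq_zmod_pow_finrank p]
  exact Nat.pow_le_pow_right (Fact.out : p.Prime).pos h

theorem index_nsmulRange_le_pow_card {B : Type*} [AddCommGroup B] [Finite B] {p : ℕ} [Fact p.Prime]
    {S : Finset B} (hS : AddSubgroup.closure (S : Set B) = ⊤) :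
    (nsmulRange B p).index ≤ p ^ S.card := by
  classical
  let _ : Module (ZMod p) (B ⧸ nsmulRange B p) :=
    QuotientAddGroup.zmodModule (H := nsmulRange B p) fun x => ⟨x, rfl⟩
  let q := QuotientAddGroup.mk' (nsmulRange B p)
  have hcl : AddSubgroup.closure ((S.image q : Finset (B ⧸ nsmulRange B p)) :
      Set (B ⧸ nsmulRange B p)) = ⊤ := by
    rw [Finset.coe_image, ← AddMonoidHom.map_closure, hS]
    exact AddSubgroup.map_top_of_surjective q (QuotientAddGroup.mk'_surjective _)
  exact (card_le_pow_card_of_closure_eq_top (p := p) hcl).trans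
    (Nat.pow_le_pow_right (Fact.out : p.Prime).pos Finset.card_image_le)

theorem index_nsmulRange_le_addSubgroupRank {R : Type*} [AddCommGroup R] [Finite R] (p : ℕ)
    [Fact p.Prime] : (nsmulRange R p).index ≤ p ^ addSubgroupRank R := by
  obtain ⟨S, hS, hcl⟩ := AddGroup.rank_spec R
  refine (index_nsmulRange_le_pow_card hcl).trans
    (Nat.pow_le_pow_right (Fact.out : p.Prime).pos ?_)
  rw [hS]
  calc AddGroup.rank R ≤ AddGroup.rank (⊤ : AddSubgroup R) :=
        AddGroup.rank_le_of_surjective (⊤ : AddSubgroup R).subtype fun x => ⟨⟨x, trivial⟩, rfl⟩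
    _ ≤ addSubgroupRank R :=
        le_ciSup (f := fun H : AddSubgroup R => AddGroup.rank H) (Set.finite_range _).bddAbove ⊤

/-! ### The ring `Hom(G, Z(G))`: index of `pR` and nilpotency. -/

namespace HomCenter

open scoped IsMulCommutative

variable {G : Type*} [Group G]

theorem hom_nsmul_apply (n : ℕ) (f : HomCenter G) (x : G) : (n • f).hom x = f.hom x ^ n := by
  induction n with
  | zero => rw [zero_smul, hom_zero_apply, pow_zero]
  | succ n ih => rw [succ_nsmul, hom_add_apply, ih, pow_succ]

theorem card_center_nsmul (f : HomCenter G) : Nat.card (Subgroup.center G) • f = 0 := by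
  ext x
  rw [hom_nsmul_apply, pow_card_eq_one', hom_zero_apply]

/-- In a finite abelian group `|R : pR| = |R[p]|`. A `p`-torsion homomorphism is determined by its
values on generators of `G`, which lie in `Z(G)[p]`, of order `|Z(G) : pZ(G)|`. -/
theorem index_nsmulRange_le [Finite G] (p : ℕ) [Fact p.Prime] :
    (nsmulRange (HomCenter G) p).index ≤
      p ^ (Group.rank G * Group.rank (Subgroup.center G)) := by
  have hZ : Nat.card (nsmulAddMonoidHom p : Additive (Subgroup.center G) →+ _).ker ≤
      p ^ Group.rank (Subgroup.center G) := by
    obtain ⟨T, hT, hcl⟩ := Group.rank_spec (Subgroup.center G)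
    rw [← AddSubgroup.index_range, ← hT]
    refine index_nsmulRange_le_pow_card (B := Additive (Subgroup.center G)) (S := T) ?_
    have := Subgroup.toAddSubgroup_closure (T : Set (Subgroup.center G))
    rw [hcl] at this
    exact this.symm
  obtain ⟨S, hS, hcl⟩ := Group.rank_spec G
  have hR : (nsmulRange (HomCenter G) p).index =
      Nat.card (nsmulAddMonoidHom p : HomCenter G →+ HomCenter G).ker := AddSubgroup.index_range
  rw [hR]
  let ev : (nsmulAddMonoidHom p : HomCenter G →+ HomCenter G).ker →
      (S → (nsmulAddMonoidHom p : Additive (Subgroup.center G) →+ _).ker) := fun f s =>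
    ⟨Additive.ofMul (f.1.hom s), by
      have h : p • f.1 = 0 := f.2
      change f.1.hom s ^ p = 1
      rw [← hom_nsmul_apply, h, hom_zero_apply]⟩
  have hev : Function.Injective ev := by
    intro f g hfg
    refine Subtype.ext (hom_injective (MonoidHom.eq_of_eqOn_dense hcl fun s hs => ?_))
    exact congrArg Subtype.val (congrFun hfg ⟨s, hs⟩)
  refine (Nat.card_le_card_of_injective ev hev).trans ?_
  rw [Nat.card_fun, Nat.card_eq_fintype_card (α := S), Fintype.card_coe, hS, mul_comm, pow_mul]
  exact Nat.pow_le_pow_left hZ _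

theorem index_nsmulRange_two [Finite G] (h : Odd (Nat.card (Subgroup.center G))) :
    (nsmulRange (HomCenter G) 2).index = 1 := by
  rw [AddSubgroup.index_eq_one, eq_top_iff]
  intro f _
  obtain ⟨k, hk⟩ := h
  refine ⟨(k + 1) • f, ?_⟩
  have h0 := card_center_nsmul f
  rw [hk] at h0
  rw [nsmulAddMonoidHom_apply, ← mul_nsmul, show (k + 1) * 2 = 2 * k + 1 + 1 by ring, succ_nsmul, h0,
    zero_add]

/-- An element of the ring as an endomorphism of `G`. -/
def toEnd (f : HomCenter G) : Monoid.End G := (Subgroup.center G).subtype.comp f.hom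

theorem exists_inr_pow_eq (f : HomCenter G) (n : ℕ) :
    ∃ g : HomCenter G, (f : Unitization ℤ (HomCenter G)) ^ (n + 1) = g ∧
      g.toEnd = f.toEnd ^ (n + 1) := by
  induction n with
  | zero => exact ⟨f, pow_one _, (pow_one _).symm⟩
  | succ n ih =>
    obtain ⟨g, hg, he⟩ := ih
    refine ⟨g * f, ?_, ?_⟩
    · rw [pow_succ, hg, Unitization.inr_mul]
    · rw [pow_succ, ← he]
      rfl

/-- An idempotent endomorphism `e` with central image gives `G = im e × ker e` with `im e` abelian.
-/
theorem eq_zero_of_toEnd_idempotent (hG : IsPurelyNonabelian G) {f : HomCenter G}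
    (hf : f.toEnd * f.toEnd = f.toEnd) : f = 0 := by
  let e : G →* G := f.toEnd
  have hidem : ∀ x, e (e x) = e x := fun x => DFunLike.congr_fun hf x
  have hcen : e.range ≤ Subgroup.center G := by
    rintro _ ⟨x, rfl⟩
    exact (f.hom x).2
  have hbot : e.range = ⊥ := by
    refine hG e.range e.ker ⟨?_⟩ inferInstance ?_ ⟨⟨?_⟩⟩
    · intro a ha g
      have := Subgroup.mem_center_iff.mp (hcen ha) g
      rwa [this, mul_inv_cancel_right]
    · rw [isCompl_iff, disjoint_iff, codisjoint_iff]
      constructor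
      · rw [eq_bot_iff]
        rintro _ ⟨⟨x, rfl⟩, hx⟩
        have hx : e (e x) = 1 := hx
        rw [hidem] at hx
        exact hx
      · rw [eq_top_iff]
        intro x _
        rw [← mul_inv_cancel_left (e x) x]
        refine Subgroup.mul_mem_sup ⟨x, rfl⟩ ?_
        rw [MonoidHom.mem_ker, map_mul, map_inv, hidem, inv_mul_cancel]
    · rintro ⟨a, ha⟩ ⟨b, hb⟩
      exact Subtype.ext (Subgroup.mem_center_iff.mp (hcen hb) a)
  ext x
  have : e x ∈ e.range := ⟨x, rfl⟩
  rw [hbot, Subgroup.mem_bot] at this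
  rw [hom_zero_apply]
  exact this

theorem isNilpotent_inr [Finite G] (hG : IsPurelyNonabelian G) (f : HomCenter G) :
    IsNilpotent (f : Unitization ℤ (HomCenter G)) := by
  have : Finite (Monoid.End G) := Finite.of_injective (fun e x => e x) DFunLike.coe_injective
  obtain ⟨m, n, hmn, h⟩ : ∃ m n : ℕ, m < n ∧ f.toEnd ^ (m + 1) = f.toEnd ^ (n + 1) := by
    obtain ⟨m, n, hne, h⟩ := Finite.exists_ne_map_eq_of_infinite fun n : ℕ => f.toEnd ^ (n + 1)
    rcases lt_or_gt_of_ne hne with hlt | hlt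
    exacts [⟨m, n, hlt, h⟩, ⟨n, m, hlt, h.symm⟩]
  obtain ⟨d, rfl⟩ := Nat.exists_eq_add_of_lt hmn
  -- powers beyond `m` are periodic with period `d + 1`
  have hper : ∀ c j, f.toEnd ^ (m + 1 + j + c * (d + 1)) = f.toEnd ^ (m + 1 + j) := by
    intro c
    induction c with
    | zero => simp
    | succ c ih =>
      intro j
      have e : m + 1 + j + (c + 1) * (d + 1) = (m + d + 1 + 1) + (j + c * (d + 1)) := by ring
      rw [e, pow_add, ← h, ← pow_add, ← add_assoc, ih]
  -- The exponent `(m + 1)(d + 1)` is a multiple of the period beyond the preperiod, so doubling it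
  -- does not change the power: `g` is idempotent.
  obtain ⟨g, hg, he⟩ := f.exists_inr_pow_eq ((m + 1) * (d + 1) - 1)
  have hpos : (m + 1) * (d + 1) - 1 + 1 = m + 1 + (m + 1) * d := by
    rw [Nat.sub_add_cancel (Nat.one_le_iff_ne_zero.mpr (by positivity))]
    ring
  rw [hpos] at hg he
  refine ⟨_, hg.trans ?_⟩
  rw [eq_zero_of_toEnd_idempotent hG (f := g), Unitization.inr_zero]
  rw [he, ← pow_add]
  have := hper (m + 1) ((m + 1) * d)
  rwa [show m + 1 + (m + 1) * d + (m + 1) * (d + 1) =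
    m + 1 + (m + 1) * d + (m + 1 + (m + 1) * d) by ring] at this

end HomCenter

/-! ### Central automorphisms and the final bounds. -/

section CentralAut

variable {G : Type*} [Group G]

/-- Since `σ` commutes with conjugation by `x`, the elements `x` and `σ x` induce the same inner
automorphism. -/
theorem inv_mul_mem_center_of_mem_centralAut {σ : MulAut G} (hσ : σ ∈ centralAut G) (x : G) :
    x⁻¹ * σ x ∈ Subgroup.center G := by
  rw [Subgroup.mem_center_iff]
  intro y
  obtain ⟨z, rfl⟩ := σ.surjective y
  have h := Subgroup.mem_centralizer_iff.mp hσ _ ⟨x, rfl⟩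
  have h := DFunLike.congr_fun h z
  simp only [MulAut.mul_apply, MulAut.conj_apply, map_mul, map_inv] at h
  have h2 : σ z * x⁻¹ = x⁻¹ * (σ x * σ z * (σ x)⁻¹) := by
    rw [← h]
    group
  calc σ z * (x⁻¹ * σ x) = (σ z * x⁻¹) * σ x := by group
    _ = x⁻¹ * σ x * σ z := by
      rw [h2]
      group

/-- The homomorphism `x ↦ x⁻¹ σ(x)` associated with a central automorphism `σ`. -/
def centralAutHom (σ : centralAut G) : G →* Subgroup.center G :=
  MonoidHom.mk' (fun x => ⟨x⁻¹ * σ.1 x, inv_mul_mem_center_of_mem_centralAut σ.2 x⟩) fun x y => by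
    refine Subtype.ext ?_
    have h := Subgroup.mem_center_iff.mp (inv_mul_mem_center_of_mem_centralAut σ.2 x) y⁻¹
    change (x * y)⁻¹ * σ.1 (x * y) = x⁻¹ * σ.1 x * (y⁻¹ * σ.1 y)
    rw [map_mul, mul_inv_rev, ← mul_assoc (x⁻¹ * σ.1 x), ← h]
    group

theorem coe_centralAutHom (σ : centralAut G) (x : G) :
    (centralAutHom σ x : G) = x⁻¹ * σ.1 x := rfl

theorem centralAut_apply (σ : centralAut G) (x : G) : σ.1 x = x * centralAutHom σ x := by
  rw [coe_centralAutHom, mul_inv_cancel_left]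

variable (G) in
/-- The embedding `σ ↦ σ - 1` of the central automorphisms into the adjoint monoid of
`Hom(G, Z(G))`. -/
def centralAutAdjointHom : AdjointHom (centralAut G) (HomCenter G) where
  toFun σ := HomCenter.of (centralAutHom σ)
  map_one' := by
    ext x
    exact inv_mul_cancel x
  map_mul' σ τ := by
    ext x
    change x⁻¹ * σ.1 (τ.1 x) = (centralAutHom σ x : G) * centralAutHom τ x *
      centralAutHom σ (centralAutHom τ x : G)
    rw [centralAut_apply τ x, map_mul, centralAut_apply σ x, centralAut_apply σ (centralAutHom τ x : G)]
    group

theorem centralAutAdjointHom_injective : Function.Injective (centralAutAdjointHom G) := by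
  intro σ τ h
  refine Subtype.ext (MulEquiv.ext fun x => ?_)
  have : centralAutHom σ = centralAutHom τ := h
  rw [centralAut_apply, centralAut_apply, this]

theorem subgroupRank_centralAut_le [Finite G] (hG : IsPurelyNonabelian G) {B : ℕ}
    (h : ∀ p : ℕ, p.Prime → ∃ i, 1 ≤ i ∧ (p = 2 → 2 ≤ i) ∧
      (nsmulRange (HomCenter G) p).index ^ (i + 1) ≤ p ^ B) :
    subgroupRank (centralAut G) ≤ B :=
  ciSup_le fun H => AdjointHom.rank_le
    ((centralAutAdjointHom G).restrict_injective centralAutAdjointHom_injective H)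
    (HomCenter.isNilpotent_inr hG) h

theorem subgroupRank_centralAut_le_three_mul [Finite G] (hG : IsPurelyNonabelian G) {B : ℕ}
    (h : ∀ p : ℕ, p.Prime → (nsmulRange (HomCenter G) p).index ≤ p ^ B) :
    subgroupRank (centralAut G) ≤ 3 * B :=
  subgroupRank_centralAut_le hG fun p hp => ⟨2, by omega, fun _ => le_rfl, by
    rw [mul_comm, pow_mul]
    exact Nat.pow_le_pow_left (h p hp) 3⟩

theorem subgroupRank_centralAut_le_two_mul [Finite G] (hG : IsPurelyNonabelian G)
    (hodd : Odd (Nat.card (Subgroup.center G))) {B : ℕ}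
    (h : ∀ p : ℕ, p.Prime → (nsmulRange (HomCenter G) p).index ≤ p ^ B) :
    subgroupRank (centralAut G) ≤ 2 * B := by
  refine subgroupRank_centralAut_le hG fun p hp => ?_
  by_cases h2 : p = 2
  · subst h2
    refine ⟨2, by omega, fun _ => le_rfl, ?_⟩
    -- For `|Z(G)|` odd, `R = 2R`, so the prime 2 imposes no cost despite needing `i = 2`.
    rw [HomCenter.index_nsmulRange_two hodd, one_pow]
    exact Nat.one_le_two_pow
  · refine ⟨1, le_rfl, fun h => absurd h h2, ?_⟩
    rw [mul_comm, pow_mul]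
    exact Nat.pow_le_pow_left (h p hp) 2

end CentralAut

theorem corollary2p8 (G : Type*) [Group G] [Finite G] (hG : IsPurelyNonabelian G) :
    subgroupRank (centralAut G) ≤ 3 * addSubgroupRank (HomCenter G) ∧
    (Odd (Nat.card (Subgroup.center G)) →
      subgroupRank (centralAut G) ≤ 2 * addSubgroupRank (HomCenter G)) ∧
    (∀ p : ℕ, p.Prime → 2 < p → IsPGroup p G →
      subgroupRank (centralAut G) ≤ 2 * (Group.rank G * Group.rank (Subgroup.center G))) ∧
    (IsPGroup 2 G →
      subgroupRank (centralAut G) ≤ 3 * (Group.rank G * Group.rank (Subgroup.center G))) := by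
  have hR : ∀ p : ℕ, p.Prime →
      (nsmulRange (HomCenter G) p).index ≤ p ^ addSubgroupRank (HomCenter G) := fun p hp =>
    have : Fact p.Prime := ⟨hp⟩
    index_nsmulRange_le_addSubgroupRank p
  have hd : ∀ p : ℕ, p.Prime → (nsmulRange (HomCenter G) p).index ≤
      p ^ (Group.rank G * Group.rank (Subgroup.center G)) := fun p hp =>
    have : Fact p.Prime := ⟨hp⟩
    HomCenter.index_nsmulRange_le p
  refine ⟨subgroupRank_centralAut_le_three_mul hG hR,
    fun hodd => subgroupRank_centralAut_le_two_mul hG hodd hR, fun p hp h2 hpG => ?_,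
    fun _ => subgroupRank_centralAut_le_three_mul hG hd⟩
  have : Fact p.Prime := ⟨hp⟩
  obtain ⟨n, hn⟩ := IsPGroup.iff_card.mp (hpG.to_subgroup (Subgroup.center G))
  refine subgroupRank_centralAut_le_two_mul hG ?_ hd
  rw [hn]
  exact (hp.odd_of_ne_two h2.ne').pow
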